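/- Let $f,g:\mathbb R^n\to(-\infty,\infty]$ be proper lower semicontinuous functions, $\operatorname{dom} f:=\{x: f(x)<\infty\}$ (likewise $\operatorname{dom} g$), and $F:=f+g$. Assume: (i) $\operatorname{dom} f$ is open, $f$ is continuously differentiable on $\operatorname{dom} f$, and $\nabla f$ is Lipschitz continuous with constant $L>0$ on a closed convex set $C$ with $\operatorname{dom} f\cap\operatorname{dom} g\subseteq C\subseteq\operatorname{dom} f$; (ii) $g$ is continuous on $\operatorname{dom} g$; (iii) there is $F_{\min}\in\mathbb R$ with $F(x)\ge F_{\min}$ for all $x\in\mathbb R^n$; (iv) $g$ is prox-bounded: there is $\gamma_g>0$ such that for all $\gamma'\in(0,\gamma_g)$ and $a\in\mathbb R^n$ the set $\operatorname{Prox}_g^{\gamma'}(a):=\arg\min_{x\in\mathbb R^n}\{g(x)+\frac1{2\gamma'}\|x-a\|^2\}$ is nonempty. For $x_0\in\operatorname{dom} g$ let the proximal subdifferential $\partial^\pi g(x_0)$ be the set of all $\xi\in\mathbb R^n$ for which there are $\sigma,\eta>0$ with $g(x)\ge g(x_0)+\langle\xi,x-x_0\rangle-\sigma\|x-x_0\|^2$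 for all $x$ with $\|x-x_0\|<\eta$. Put $S_{\rm cano}(p):=\{x\in\operatorname{dom} f\cap\operatorname{dom} g: p\in\nabla f(x)+\partial^\pi g(x)\}$ and $\mathcal X^\pi:=S_{\rm cano}(0)$. Let $0<\gamma<1/L$, and let $\{x^k\}_{k\ge0}\subseteq\operatorname{dom} f$ be a sequence generated by the proximal gradient (PG) method, i.e. $x^{k+1}\in\operatorname{Prox}_g^{\gamma}(x^k-\gamma\nabla f(x^k))$ for all $k\ge0$. Let $\bar x$ be an accumulation point of $\{x^k\}$. Then $\bar x\in\mathcal X^\pi$. Suppose in addition that (a) (proper separation of stationary values at $\bar x$) there is $\epsilon>0$ such that $F(x)=F(\bar x)$ for all $x\in\mathcal X^\pi$ with $\|x-\bar x\|<\epsilon$; and (b) $S_{\rm cano}$ is calm at $(0,\bar x)$: there are a neighborhood $U$ of $0$, a neighborhood $V$ of $\bar x$ and $\kappa\ge0$ such that $S_{\rm cano}(p)\cap V\subseteq S_{\rm cano}(0)+\kappa\|p\|\overline{\mathbb B}$ for all $p\in U$, where $\overline{\mathbb B}$ is the closed unit ball. Then the whole sequence $\{x^k\}$ converges to $\bar x$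 linearly: $x^k\to\bar x$, $F(\bar x)<\infty$, and there are $k_0\in\mathbb N$, $\sigma\in(0,1)$, $\rho_0>0$ and $\rho\in(0,1)$ such that for all $k\ge k_0$, $F(x^k)<\infty$, $$F(x^{k+1})-F(\bar x)\le\sigma\,(F(x^k)-F(\bar x))\quad\text{and}\quad\|x^k-\bar x\|\le\rho_0\,\rho^k .$$ -/

import Mathlib

open Filter Topology
open scoped Pointwise

noncomputable section

namespace ProxGrad

/-- The space `ℝⁿ` with its Euclidean norm and inner product. -/
abbrev Vec (n : ℕ) : Type := EuclideanSpace ℝ (Fin n)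

variable {n : ℕ}

/-- The (effective) domain `{x | φ x < ∞}` of an extended-real-valued function. -/
def dom (φ : Vec n → EReal) : Set (Vec n) := {x | φ x < ⊤}

/-- A proper function: its values are in `(-∞, ∞]`, and it is finite at some point. -/
def IsProper (φ : Vec n → EReal) : Prop := (∀ x, φ x ≠ ⊥) ∧ (dom φ).Nonempty

/-- The finite part of `φ`; it is the real-valued function `φ` on `dom φ` when `φ` is proper. -/
def finitePart (φ : Vec n → EReal) (x : Vec n) : ℝ := (φ x).toReal

/-- The gradient of `φ`, to be used at interior points of `dom φ` only. -/
def grad (φ : Vec n → EReal) (x : Vec n) : Vec n := gradient (finitePart φ) x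

/-- The proximal operator `Prox_g^γ(a) = argmin_x { g(x) + ‖x - a‖² / (2γ) }`, a set. -/
def prox (g : Vec n → EReal) (γ : ℝ) (a : Vec n) : Set (Vec n) :=
  {x | ∀ y, g x + ((1 / (2 * γ) * ‖x - a‖ ^ 2 : ℝ) : EReal) ≤
    g y + ((1 / (2 * γ) * ‖y - a‖ ^ 2 : ℝ) : EReal)}

/-- Prox-boundedness: for all small step sizes the proximal operator is well defined, that is,
the minimum in its definition is attained for every `a`. -/
def ProxBounded (g : Vec n → EReal) : Prop :=
  ∃ γg : ℝ, 0 < γg ∧ ∀ γ : ℝ, 0 < γ → γ < γg → ∀ a, (prox g γ a).Nonempty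

/-- The proximal subdifferential `∂^π φ(x₀)`; it is empty when `x₀ ∉ dom φ`. -/
def proxSubdiff (φ : Vec n → EReal) (x₀ : Vec n) : Set (Vec n) :=
  {ξ | x₀ ∈ dom φ ∧ ∃ σ : ℝ, 0 < σ ∧ ∃ η : ℝ, 0 < η ∧ ∀ x ∈ Metric.ball x₀ η,
    φ x₀ + ((inner ℝ ξ (x - x₀) - σ * ‖x - x₀‖ ^ 2 : ℝ) : EReal) ≤ φ x}

/-- `x` is a sequence generated by the proximal gradient method with step size `γ`.
All iterates lie in `dom f`, so that the gradients in the iteration exist. -/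
def IsPGSequence (f g : Vec n → EReal) (γ : ℝ) (x : ℕ → Vec n) : Prop :=
  ∀ k, x k ∈ dom f ∧ x (k + 1) ∈ prox g γ (x k - γ • grad f (x k))

/-- The canonically perturbed stationary point map
`S_cano(p) = {x | p ∈ ∇f(x) + ∂^π g(x)}` (where `∇f(x)` only exists for `x ∈ dom f`). -/
def Scano (f g : Vec n → EReal) (p : Vec n) : Set (Vec n) :=
  {x | x ∈ dom f ∧ p ∈ ({grad f x} : Set (Vec n)) + proxSubdiff g x}

/-- The set `X^π = {x | 0 ∈ ∇f(x) + ∂^π g(x)}` of proximal stationary points. -/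
def Xpi (f g : Vec n → EReal) : Set (Vec n) :=
  {x | x ∈ dom f ∧ (0 : Vec n) ∈ ({grad f x} : Set (Vec n)) + proxSubdiff g x}

/-- Calmness of a set-valued map `S` at the point `(p₀, x₀)` of its graph. -/
def IsCalmAt (S : Vec n → Set (Vec n)) (p₀ x₀ : Vec n) : Prop :=
  x₀ ∈ S p₀ ∧ ∃ U ∈ 𝓝 p₀, ∃ V ∈ 𝓝 x₀, ∃ κ : ℝ, 0 ≤ κ ∧
    ∀ p ∈ U, S p ∩ V ⊆ S p₀ + (κ * ‖p - p₀‖) • Metric.closedBall (0 : Vec n) 1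

/-- Proper separation of stationary values of `F = f + g` at `x₀ ∈ X^π`. -/
def ProperSeparation (f g : Vec n → EReal) (x₀ : Vec n) : Prop :=
  x₀ ∈ Xpi f g ∧ ∃ ε : ℝ, 0 < ε ∧ ∀ x ∈ Xpi f g ∩ Metric.ball x₀ ε, f x + g x = f x₀ + g x₀

/-- Linear convergence of `x` to `x₀`: the sequence converges to `x₀`, and from some index on the
(finite) values of `F` decrease to `F x₀` with a constant contraction factor, and the distance to
`x₀` is bounded by a geometric sequence. -/
def ConvergesLinearly (F : Vec n → EReal) (x : ℕ → Vec n) (x₀ : Vec n) : Prop :=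
  Tendsto x atTop (𝓝 x₀) ∧ x₀ ∈ dom F ∧
    ∃ k₀ : ℕ, ∃ σ ρ₀ ρ : ℝ, 0 < σ ∧ σ < 1 ∧ 0 < ρ₀ ∧ 0 < ρ ∧ ρ < 1 ∧
      ∀ k, k₀ ≤ k → x k ∈ dom F ∧
        (F (x (k + 1))).toReal - (F x₀).toReal ≤ σ * ((F (x k)).toReal - (F x₀).toReal) ∧
        ‖x k - x₀‖ ≤ ρ₀ * ρ ^ k

end ProxGrad

end

/-! Two inequalities, both quadratic in the step `d = ‖x (k + 1) - x k‖`, drive the proof. Comparing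
the proximal step with `x k` itself and bounding `f` by `descent_lemma` gives sufficient decrease:
`F` drops by at least `a * d ^ 2`. Hence steps vanish, and the proximal inequality passes to the
limit, so a cluster point is stationary.

For the reverse inequality, each new iterate solves the stationarity inclusion perturbed by a
residual of size `O(d)` (`mem_Scano_of_mem_prox`). Calmness then supplies a stationary `z` at
distance `O(d)`, and separation gives `F z = F xbar`. Comparing the proximal step with `z` yields `F
(x (k + 1)) - F xbar ≤ c * d ^ 2` near `xbar`.

Together these contract the value gap by `c / (a + c)`, so the steps decay geometrically. Their sum
is small enough to keep the iterates near `xbar`, where the second inequality holds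
(`linear_convergence_of_descent`). -/

namespace ProxGrad

/-! ### Abstract descent sequences -/

section Abstract

variable {E : Type*} [NormedAddCommGroup E]

/-- Square summability of the steps, in the weak form that they tend to zero. -/
theorem tendsto_step_zero {x : ℕ → E} {V : ℕ → ℝ} {a m : ℝ} {N : ℕ} (ha : 0 < a)
    (hm : ∀ k, N ≤ k → m ≤ V k)
    (hdesc : ∀ k, N ≤ k → V (k + 1) + a * ‖x (k + 1) - x k‖ ^ 2 ≤ V k) :
    Tendsto (fun k => ‖x (k + 1) - x k‖) atTop (𝓝 0) := by
  have hanti : Antitone (fun k => V (k + N)) := by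
    refine antitone_nat_of_succ_le fun k => ?_
    have h := hdesc (k + N) (by omega)
    have h2 : 0 ≤ a * ‖x (k + N + 1) - x (k + N)‖ ^ 2 := by positivity
    rw [show k + 1 + N = k + N + 1 by omega]
    linarith
  have hbdd : BddBelow (Set.range fun k => V (k + N)) := by
    refine ⟨m, ?_⟩
    rintro _ ⟨k, rfl⟩
    exact hm _ (by omega)
  have hlim := tendsto_atTop_ciInf hanti hbdd
  have hlim' := hlim.comp (tendsto_add_atTop_nat 1)
  have hdiff := (hlim.sub hlim').div_const a
  rw [sub_self, zero_div] at hdiff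
  rw [← tendsto_add_atTop_iff_nat N]
  have hsq : Tendsto (fun k => ‖x (k + N + 1) - x (k + N)‖ ^ 2) atTop (𝓝 0) := by
    refine squeeze_zero (fun k => by positivity) (fun k => ?_) hdiff
    have h := hdesc (k + N) (by omega)
    simp only [Function.comp_apply]
    rw [le_div_iff₀ ha, show k + 1 + N = k + N + 1 by omega]
    linarith
  have := hsq.sqrt
  simpa [Real.sqrt_sq (norm_nonneg _)] using this

/-- A sequence with sufficient decrease of the merit values `V`, for which near a cluster point
the merit values are bounded by the squared steps, converges linearly to the cluster point. -/
theorem linear_convergence_of_descent [CompleteSpace E] {x : ℕ → E} {V : ℕ → ℝ} {p : E}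
    {a c δ : ℝ} {N : ℕ} (ha : 0 < a) (hc : 0 < c) (hδ : 0 < δ)
    (hp : MapClusterPt p atTop x) (hV : ∀ k, N ≤ k → 0 ≤ V k)
    (hdesc : ∀ k, N ≤ k → V (k + 1) + a * ‖x (k + 1) - x k‖ ^ 2 ≤ V k)
    (herr : ∀ k, N ≤ k → ‖x (k + 1) - p‖ < δ → V (k + 1) ≤ c * ‖x (k + 1) - x k‖ ^ 2) :
    Tendsto x atTop (𝓝 p) ∧ ∃ k₀ : ℕ, N ≤ k₀ ∧ ∃ σ ρ₀ ρ : ℝ,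
      0 < σ ∧ σ < 1 ∧ 0 < ρ₀ ∧ 0 < ρ ∧ ρ < 1 ∧
      ∀ k, k₀ ≤ k → V (k + 1) ≤ σ * V k ∧ ‖x k - p‖ ≤ ρ₀ * ρ ^ k := by
  have hstep := tendsto_step_zero ha hV hdesc
  -- Eliminating the squared step from the two inequalities gives `(a + c) * V (k + 1) ≤ c * V k`.
  set σ : ℝ := c / (a + c) with hσ
  have hσ0 : 0 < σ := by positivity
  have hσ1 : σ < 1 := by rw [hσ, div_lt_one (by positivity)]; linarith
  set r : ℝ := √σ with hr
  have hr0 : 0 < r := Real.sqrt_pos.2 hσ0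
  have hr1 : r < 1 := by rw [hr, Real.sqrt_lt' one_pos]; linarith
  have hrσ : r ^ 2 = σ := Real.sq_sqrt hσ0.le
  have h1r : 0 < 1 - r := by linarith
  have hcontr : ∀ k, N ≤ k → ‖x (k + 1) - p‖ < δ → V (k + 1) ≤ σ * V k := by
    intro k hk hkδ
    have h1 := hdesc k hk
    have h2 := herr k hk hkδ
    rw [hσ, div_mul_eq_mul_div, le_div_iff₀ (by positivity)]
    nlinarith
  have hanti : ∀ k, N ≤ k → V (k + 1) ≤ V k := fun k hk => by
    have h1 := hdesc k hk
    have h2 : 0 ≤ a * ‖x (k + 1) - x k‖ ^ 2 := by positivity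
    linarith
  have hfreq : ∀ ε > 0, ∃ᶠ k in atTop, ‖x k - p‖ < ε := by
    intro ε hε
    have := hp.frequently (Metric.ball_mem_nhds p hε)
    simpa [dist_eq_norm] using this
  -- The error bound makes `V` small at the infinitely many visits to the ball; monotonicity extends
  -- this to all later indices.
  have hV0 : Tendsto V atTop (𝓝 0) := by
    have hsq : Tendsto (fun k => c * ‖x (k + 1) - x k‖ ^ 2) atTop (𝓝 0) := by
      simpa using (hstep.pow 2).const_mul c
    rw [Metric.tendsto_atTop]
    intro ε hε
    obtain ⟨K, hK⟩ := eventually_atTop.1 (hsq.eventually_lt_const hε)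
    obtain ⟨k, hk, hkδ⟩ := frequently_atTop.1 (hfreq δ hδ) (max K N + 1)
    obtain ⟨j, rfl⟩ : ∃ j, k = j + 1 := ⟨k - 1, by omega⟩
    have hjN : N ≤ j := by have := le_max_right K N; omega
    have hjK : K ≤ j := by have := le_max_left K N; omega
    refine ⟨j + 1, fun i hi => ?_⟩
    have hle : V i ≤ V (j + 1) := by
      induction i, hi using Nat.le_induction with
      | base => exact le_rfl
      | succ i hi ih => exact (hanti i (by omega)).trans ih
    rw [Real.dist_eq, sub_zero, abs_of_nonneg (hV i (by omega))]
    exact (hle.trans (herr j hjN hkδ)).trans_lt (hK j hjK)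
  have hM0 : Tendsto (fun k => √(V k / a) / (1 - r)) atTop (𝓝 0) := by
    simpa using ((hV0.div_const a).sqrt).div_const (1 - r)
  -- Half of `δ` covers the distance of `x k₀` to `p`, the other half the sum of the geometric
  -- bounds on all later steps.
  obtain ⟨k₀, hk₀δ, hk₀M, hk₀N⟩ := ((hfreq (δ / 2) (by positivity)).and_eventually
    ((hM0.eventually_lt_const (show (0 : ℝ) < δ / 2 by positivity)).and
      (eventually_ge_atTop N))).exists
  set M : ℝ := √(V k₀ / a) with hM
  have hM_nonneg : 0 ≤ M := Real.sqrt_nonneg _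
  have hMsq : a * M ^ 2 = V k₀ := by
    rw [hM, Real.sq_sqrt (div_nonneg (hV _ hk₀N) ha.le)]
    field_simp
  have hstep_le : ∀ m, V (k₀ + m) ≤ V k₀ * σ ^ m →
      ‖x (k₀ + m + 1) - x (k₀ + m)‖ ≤ M * r ^ m := by
    intro m hm
    refine le_of_sq_le_sq ?_ (by positivity)
    have h1 := hdesc (k₀ + m) (by omega)
    have h2 := hV (k₀ + m + 1) (by omega)
    refine le_of_mul_le_mul_left ?_ ha
    rw [mul_pow, ← pow_mul, mul_comm m 2, pow_mul, hrσ, ← mul_assoc, hMsq]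
    linarith
  -- Reserving the tail of the geometric series breaks the circularity: the bound on `V` controls
  -- the next step, so the next iterate stays in the ball, where the contraction applies again.
  have hinv : ∀ m, V (k₀ + m) ≤ V k₀ * σ ^ m ∧
      ‖x (k₀ + m) - p‖ + M * r ^ m / (1 - r) < δ := by
    intro m
    induction m with
    | zero => simp only [add_zero, pow_zero, mul_one, le_refl, true_and]; linarith
    | succ m ih =>
      have hs := hstep_le m ih.1
      have htri : ‖x (k₀ + m + 1) - p‖ ≤ ‖x (k₀ + m + 1) - x (k₀ + m)‖ + ‖x (k₀ + m) - p‖ :=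
        norm_sub_le_norm_sub_add_norm_sub _ _ _
      have hgeo : M * r ^ m / (1 - r) = M * r ^ m + M * r ^ (m + 1) / (1 - r) := by
        field_simp
        ring
      have hball : ‖x (k₀ + m + 1) - p‖ + M * r ^ (m + 1) / (1 - r) < δ := by linarith [ih.2]
      refine ⟨?_, hball⟩
      have hpos : 0 ≤ M * r ^ (m + 1) / (1 - r) := by positivity
      have := hcontr (k₀ + m) (by omega) (by linarith)
      calc V (k₀ + (m + 1)) ≤ σ * V (k₀ + m) := this
        _ ≤ σ * (V k₀ * σ ^ m) := by gcongr; exact ih.1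
        _ = V k₀ * σ ^ (m + 1) := by ring
  have hdist : ∀ m, dist (x (k₀ + m)) (x (k₀ + (m + 1))) ≤ M * r ^ m := by
    intro m
    rw [dist_comm, dist_eq_norm]
    exact hstep_le m (hinv m).1
  obtain ⟨l, hl⟩ := cauchySeq_tendsto_of_complete
    (cauchySeq_of_le_geometric r M hr1 hdist)
  have hxl : Tendsto x atTop (𝓝 l) := by
    rw [← tendsto_add_atTop_iff_nat k₀]
    simpa only [add_comm] using hl
  obtain ⟨ψ, hψ, hψp⟩ := hp.tendsto_subseq
  obtain rfl : l = p := tendsto_nhds_unique (hxl.comp hψ.tendsto_atTop) hψp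
  -- The `+ 1` keeps `ρ₀` positive when `M = 0`; dividing by `r ^ k₀` converts the rate from `m` to
  -- `k₀ + m`.
  refine ⟨hxl, k₀, hk₀N, σ, (M / (1 - r) + 1) / r ^ k₀, r, hσ0, hσ1, by positivity, hr0, hr1, ?_⟩
  intro k hk
  obtain ⟨m, rfl⟩ := Nat.exists_eq_add_of_le hk
  constructor
  · refine hcontr _ (by omega) ?_
    have := (hinv (m + 1)).2
    have hpos : 0 ≤ M * r ^ (m + 1) / (1 - r) := by positivity
    rw [add_assoc]
    linarith
  · have h := dist_le_of_le_geometric_of_tendsto r M hr1 hdist hl m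
    rw [dist_eq_norm] at h
    refine h.trans ?_
    rw [pow_add]
    have hrm : 0 < r ^ m := by positivity
    have hrk : 0 < r ^ k₀ := by positivity
    calc M * r ^ m / (1 - r) = M / (1 - r) * r ^ m := by ring
      _ ≤ (M / (1 - r) + 1) * r ^ m := by gcongr; linarith
      _ = (M / (1 - r) + 1) / r ^ k₀ * (r ^ k₀ * r ^ m) := by field_simp

end Abstract

/-! ### Quadratic upper bound for smooth functions -/

/-- The descent lemma for a function with Lipschitz continuous gradient on a convex set. -/
theorem descent_lemma {E : Type*} [NormedAddCommGroup E] [InnerProductSpace ℝ E] [CompleteSpace E]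
    {φ : E → ℝ} {G : E → E} {C : Set E} {L : ℝ} (hC : Convex ℝ C)
    (hφ : ∀ x ∈ C, HasGradientAt φ (G x) x)
    (hG : ∀ x ∈ C, ∀ y ∈ C, ‖G x - G y‖ ≤ L * ‖x - y‖) {x y : E} (hx : x ∈ C) (hy : y ∈ C) :
    φ y ≤ φ x + inner ℝ (G x) (y - x) + L / 2 * ‖y - x‖ ^ 2 := by
  set v := y - x with hv
  have hmem : ∀ t ∈ Set.Icc (0 : ℝ) 1, x + t • v ∈ C := fun t ht =>
    hC.add_smul_sub_mem hx hy ht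
  -- Along the segment, `φ` minus its claimed upper bound is antitone: Cauchy–Schwarz and the
  -- Lipschitz bound make the derivative nonpositive.
  have hder : ∀ t ∈ Set.Icc (0 : ℝ) 1, HasDerivAt
      (fun t : ℝ => φ (x + t • v) - t * inner ℝ (G x) v - L / 2 * ‖v‖ ^ 2 * t ^ 2)
      (inner ℝ (G (x + t • v)) v - inner ℝ (G x) v - L / 2 * ‖v‖ ^ 2 * (2 * t)) t := by
    intro t ht
    have hline : HasDerivAt (fun t : ℝ => x + t • v) v t := by
      simpa using ((hasDerivAt_id t).smul_const v).const_add x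
    have h1 := (hφ _ (hmem t ht)).hasFDerivAt.comp_hasDerivAt t hline
    have h2 := (hasDerivAt_id t).mul_const (inner ℝ (G x) v)
    have h3 := (hasDerivAt_pow 2 t).const_mul (L / 2 * ‖v‖ ^ 2)
    refine ((h1.sub h2).sub h3).congr_deriv ?_
    simp
  have hanti := antitoneOn_of_deriv_nonpos (convex_Icc (0 : ℝ) 1)
    (fun t ht => (hder t ht).continuousAt.continuousWithinAt)
    (fun t ht => (hder t (interior_subset ht)).differentiableAt.differentiableWithinAt)
    (fun t ht => by
      have ht' := interior_subset ht
      rw [(hder t ht').deriv, ← inner_sub_left]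
      have h1 := real_inner_le_norm (G (x + t • v) - G x) v
      have h2 := hG _ (hmem t ht') _ hx
      rw [add_sub_cancel_left, norm_smul, Real.norm_of_nonneg ht'.1] at h2
      nlinarith [norm_nonneg v])
  have h := hanti (Set.left_mem_Icc.2 zero_le_one) (Set.right_mem_Icc.2 zero_le_one) zero_le_one
  simp only [one_smul, zero_smul, add_zero, one_mul, zero_mul, hv, add_sub_cancel] at h
  norm_num at h
  linarith

/-! ### Optimality and residuals of proximal steps -/

variable {n : ℕ} {f g : Vec n → EReal}

theorem coe_finitePart (hg : IsProper g) {x : Vec n} (hx : x ∈ dom g) :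
    ((finitePart g x : ℝ) : EReal) = g x :=
  EReal.coe_toReal (ne_of_lt hx) (hg.1 x)

theorem mem_dom_of_mem_prox (hg : IsProper g) {γ : ℝ} {a x : Vec n} (hx : x ∈ prox g γ a) :
    x ∈ dom g := by
  obtain ⟨y, hy⟩ := hg.2
  have h := hx y
  rw [← coe_finitePart hg hy, ← EReal.coe_add] at h
  by_contra hne
  have htop : g x = ⊤ := not_lt_top_iff.1 hne
  rw [htop, EReal.top_add_coe] at h
  exact absurd h (not_le.2 (EReal.coe_lt_top _))

theorem prox_le (hg : IsProper g) {γ : ℝ} {a x y : Vec n} (hx : x ∈ prox g γ a) (hy : y ∈ dom g) :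
    finitePart g x + 1 / (2 * γ) * ‖x - a‖ ^ 2 ≤ finitePart g y + 1 / (2 * γ) * ‖y - a‖ ^ 2 := by
  have h := hx y
  rw [← coe_finitePart hg hy, ← coe_finitePart hg (mem_dom_of_mem_prox hg hx)] at h
  exact_mod_cast h

/-- The optimality of a proximal gradient step, with the square of the gradient removed. -/
theorem prox_step_le (hg : IsProper g) {γ : ℝ} (hγ : 0 < γ) {u v w z : Vec n}
    (hv : v ∈ prox g γ (u - γ • w)) (hz : z ∈ dom g) :
    finitePart g v + inner ℝ w (v - u) + 1 / (2 * γ) * ‖v - u‖ ^ 2 ≤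
      finitePart g z + inner ℝ w (z - u) + 1 / (2 * γ) * ‖z - u‖ ^ 2 := by
  have h := prox_le hg hv hz
  have hexp : ∀ y : Vec n, 1 / (2 * γ) * ‖y - (u - γ • w)‖ ^ 2 =
      inner ℝ w (y - u) + 1 / (2 * γ) * ‖y - u‖ ^ 2 + γ / 2 * ‖w‖ ^ 2 := by
    intro y
    rw [show y - (u - γ • w) = (y - u) + γ • w by abel, norm_add_sq_real, inner_smul_right,
      norm_smul, Real.norm_of_nonneg hγ.le, real_inner_comm]
    field_simp
    ring
  rw [hexp v, hexp z] at h
  linarith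

/-- Expanding `‖y - a‖ ^ 2` around `x` turns global minimality into the subgradient inequality with
modulus `1 / (2 * γ)`. It holds for every `y`, so the radius `1` is arbitrary. -/
theorem smul_sub_mem_proxSubdiff (hg : IsProper g) {γ : ℝ} (hγ : 0 < γ) {a x : Vec n}
    (hx : x ∈ prox g γ a) : (1 / γ) • (a - x) ∈ proxSubdiff g x := by
  have hxd := mem_dom_of_mem_prox hg hx
  refine ⟨hxd, 1 / (2 * γ), by positivity, 1, one_pos, fun y _ => ?_⟩
  by_cases hy : y ∈ dom g
  · rw [← coe_finitePart hg hy, ← coe_finitePart hg hxd, ← EReal.coe_add, EReal.coe_le_coe_iff]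
    have h := prox_le hg hx hy
    rw [norm_sub_rev x a, show y - a = (y - x) - (a - x) by abel, norm_sub_sq_real (y - x),
      real_inner_comm] at h
    rw [inner_smul_left]
    have h3 : 1 / (2 * γ) * (‖y - x‖ ^ 2 - 2 * inner ℝ (a - x) (y - x) + ‖a - x‖ ^ 2) =
      1 / (2 * γ) * ‖y - x‖ ^ 2 - 1 / γ * inner ℝ (a - x) (y - x)
        + 1 / (2 * γ) * ‖a - x‖ ^ 2 := by
      field_simp
    rw [h3] at h
    simp only [conj_trivial]
    linarith
  · rw [show g y = ⊤ from not_lt_top_iff.1 hy]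
    exact le_top

/-- The step optimality condition involves the gradient at `u`; replacing it by the gradient at `v`
leaves a residual that is `O(‖v - u‖)` when the gradient is Lipschitz. This is the perturbation fed
to calmness. -/
theorem mem_Scano_of_mem_prox (hg : IsProper g) {γ : ℝ} (hγ : 0 < γ) {u v : Vec n}
    (hvf : v ∈ dom f) (hv : v ∈ prox g γ (u - γ • grad f u)) :
    v ∈ Scano f g (grad f v - grad f u - (1 / γ) • (v - u)) := by
  refine ⟨hvf, Set.mem_add.2 ⟨_, rfl, _, smul_sub_mem_proxSubdiff hg hγ hv, ?_⟩⟩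
  rw [show u - γ • grad f u - v = -(v - u) - γ • grad f u by abel, smul_sub, smul_smul,
    one_div_mul_cancel hγ.ne', one_smul, smul_neg]
  abel

theorem mem_dom_of_mem_Xpi {x : Vec n} (hx : x ∈ Xpi f g) : x ∈ dom f ∩ dom g := by
  obtain ⟨hxf, a, -, b, hb, -⟩ := hx
  exact ⟨hxf, hb.1⟩

/-- Passing to the limit in an upper bound for a lower semicontinuous function. -/
theorem lsc_le_of_tendsto {φ : Vec n → EReal} (hφ : LowerSemicontinuous φ) {u : ℕ → Vec n}
    {p : Vec n} {c : ℕ → ℝ} {c₀ : ℝ} (hu : Tendsto u atTop (𝓝 p)) (hc : Tendsto c atTop (𝓝 c₀))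
    (hle : ∀ᶠ j in atTop, φ (u j) ≤ (c j : EReal)) : φ p ≤ (c₀ : EReal) := by
  by_contra hlt
  rw [not_le] at hlt
  obtain ⟨s, hs1, hs2⟩ := EReal.lt_iff_exists_real_btwn.1 hlt
  have h1 := hu.eventually (hφ p _ hs2)
  have h2 := hc.eventually_lt_const (EReal.coe_lt_coe_iff.1 hs1)
  obtain ⟨j, hj1, hj2, hj3⟩ := (h1.and (h2.and hle)).exists
  exact absurd (hj1.trans_le hj3) (not_lt.2 (EReal.coe_le_coe_iff.2 hj2.le))

theorem hasGradientAt_grad (hf_open : IsOpen (dom f))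
    (hf_smooth : ContDiffOn ℝ 1 (finitePart f) (dom f)) {x : Vec n} (hx : x ∈ dom f) :
    HasGradientAt (finitePart f) (grad f x) x :=
  (((hf_smooth.differentiableOn one_ne_zero) x hx).differentiableAt
    (hf_open.mem_nhds hx)).hasGradientAt

end ProxGrad

/-! ### Stationarity of cluster points and linear convergence -/

open ProxGrad

theorem theorem4p2 {n : ℕ}
    (f g : ProxGrad.Vec n → EReal)
    -- `f` is proper, lsc, and smooth on its open domain
    (hf_proper : ProxGrad.IsProper f) (hf_lsc : LowerSemicontinuous f)
    (hf_open : IsOpen (ProxGrad.dom f))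
    (hf_smooth : ContDiffOn ℝ 1 (ProxGrad.finitePart f) (ProxGrad.dom f))
    -- `∇f` is `L`-Lipschitz on a closed convex set `C ⊇ dom f ∩ dom g`, on which it exists
    (L : ℝ) (hL : 0 < L) (C : Set (ProxGrad.Vec n))
    (hC_closed : IsClosed C) (hC_convex : Convex ℝ C) (hC_sub : C ⊆ ProxGrad.dom f)
    (hC_sup : ProxGrad.dom f ∩ ProxGrad.dom g ⊆ C)
    (hf_lip : ∀ x ∈ C, ∀ y ∈ C, ‖ProxGrad.grad f x - ProxGrad.grad f y‖ ≤ L * ‖x - y‖)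
    -- `g` is proper, lsc, continuous on its domain, and prox-bounded
    (hg_proper : ProxGrad.IsProper g) (hg_lsc : LowerSemicontinuous g)
    (hg_cont : ContinuousOn g (ProxGrad.dom g)) (hg_prox : ProxGrad.ProxBounded g)
    -- `F = f + g` is bounded below
    (Fmin : ℝ) (hF_min : ∀ x, (Fmin : EReal) ≤ f x + g x)
    -- a proximal gradient sequence with step size `γ < 1 / L`, and an accumulation point of it
    (γ : ℝ) (hγ : 0 < γ) (hγL : γ < 1 / L)
    (x : ℕ → ProxGrad.Vec n) (hx : ProxGrad.IsPGSequence f g γ x)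
    (xbar : ProxGrad.Vec n) (hxbar : MapClusterPt xbar atTop x) :
    xbar ∈ ProxGrad.Xpi f g ∧
      (ProxGrad.ProperSeparation f g xbar →
        ProxGrad.IsCalmAt (ProxGrad.Scano f g) 0 xbar →
        ProxGrad.ConvergesLinearly (fun y => f y + g y) x xbar) := by
  obtain ⟨ψ, hψ, hψlim⟩ := hxbar.tendsto_subseq
  have hxf : ∀ k, x k ∈ dom f := fun k => (hx k).1
  -- The starting point need not lie in `dom g`, so estimates on values start at index `1`.
  have hxg : ∀ k, 1 ≤ k → x k ∈ dom g := by
    intro k hk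
    obtain ⟨j, rfl⟩ : ∃ j, k = j + 1 := ⟨k - 1, by omega⟩
    exact mem_dom_of_mem_prox hg_proper (hx j).2
  have hxC : ∀ k, 1 ≤ k → x k ∈ C := fun k hk => hC_sup ⟨hxf k, hxg k hk⟩
  have hgrad : ∀ y ∈ dom f, HasGradientAt (finitePart f) (grad f y) y := fun y hy =>
    hasGradientAt_grad hf_open hf_smooth hy
  have hdl : ∀ y ∈ C, ∀ z ∈ C, finitePart f z ≤
      finitePart f y + inner ℝ (grad f y) (z - y) + L / 2 * ‖z - y‖ ^ 2 := fun y hy z hz =>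
    descent_lemma hC_convex (fun w hw => hgrad w (hC_sub hw)) hf_lip hy hz
  set Φ : Vec n → ℝ := fun y => finitePart f y + finitePart g y with hΦ
  have hΦF : ∀ y ∈ dom f ∩ dom g, ((Φ y : ℝ) : EReal) = f y + g y := by
    intro y hy
    rw [hΦ, EReal.coe_add, coe_finitePart hf_proper hy.1, coe_finitePart hg_proper hy.2]
  have hΦmin : ∀ y ∈ dom f ∩ dom g, Fmin ≤ Φ y := by
    intro y hy
    have := hF_min y
    rw [← hΦF y hy] at this
    exact_mod_cast this
  -- The proximal coefficient `1 / (2 * γ)` minus the curvature `L / 2` of the descent lemma.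
  set a : ℝ := (1 / γ - L) / 2 with ha_def
  have ha : 0 < a := by
    have : L < 1 / γ := by rwa [lt_one_div hL hγ]
    rw [ha_def]
    linarith
  have hdesc : ∀ k, 1 ≤ k → Φ (x (k + 1)) + a * ‖x (k + 1) - x k‖ ^ 2 ≤ Φ (x k) := by
    intro k hk
    have h1 := prox_step_le hg_proper hγ (hx k).2 (hxg k hk)
    have h2 := hdl _ (hxC k hk) _ (hxC (k + 1) (by omega))
    have h3 : 1 / (2 * γ) = a + L / 2 := by rw [ha_def]; field_simp; ring
    rw [sub_self, inner_zero_right, norm_zero, h3] at h1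
    simp only [hΦ]
    nlinarith
  have hd0 : Tendsto (fun k => ‖x (k + 1) - x k‖) atTop (𝓝 0) :=
    tendsto_step_zero ha (fun k hk => hΦmin _ ⟨hxf k, hxg k hk⟩) hdesc
  have hψge : ∀ᶠ j in atTop, 1 ≤ ψ j := hψ.tendsto_atTop.eventually_ge_atTop 1
  have hlim1 : Tendsto (fun j => x (ψ j + 1)) atTop (𝓝 xbar) := by
    have h := tendsto_zero_iff_norm_tendsto_zero.2 (hd0.comp hψ.tendsto_atTop)
    simpa using (h.add hψlim)
  have hbarC : xbar ∈ C := hC_closed.mem_of_tendsto hψlim (hψge.mono fun j hj => hxC _ hj)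
  have hbarf : xbar ∈ dom f := hC_sub hbarC
  have hgradlim : Tendsto (fun j => grad f (x (ψ j))) atTop (𝓝 (grad f xbar)) := by
    rw [tendsto_iff_norm_sub_tendsto_zero]
    have h : Tendsto (fun j => L * ‖x (ψ j) - xbar‖) atTop (𝓝 0) := by
      simpa using (tendsto_iff_norm_sub_tendsto_zero.1 hψlim).const_mul L
    exact squeeze_zero' (Eventually.of_forall fun j => norm_nonneg _)
      (hψge.mono fun j hj => hf_lip _ (hxC _ hj) _ hbarC) h
  -- This is the proximal inequality in the limit, so `xbar` is a fixed point of the step. The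
  -- vanishing `xbar - xbar` terms are kept to match the limit termwise.
  have hprox_real : ∀ y ∈ dom g, g xbar ≤ ((finitePart g y + (inner ℝ (grad f xbar) (y - xbar) +
      1 / (2 * γ) * ‖y - xbar‖ ^ 2) - (inner ℝ (grad f xbar) (xbar - xbar) +
      1 / (2 * γ) * ‖xbar - xbar‖ ^ 2) : ℝ) : EReal) := by
    intro y hy
    refine lsc_le_of_tendsto hg_lsc hlim1 (c := fun j => finitePart g y +
      (inner ℝ (grad f (x (ψ j))) (y - x (ψ j)) + 1 / (2 * γ) * ‖y - x (ψ j)‖ ^ 2) -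
      (inner ℝ (grad f (x (ψ j))) (x (ψ j + 1) - x (ψ j)) +
        1 / (2 * γ) * ‖x (ψ j + 1) - x (ψ j)‖ ^ 2)) ?_ ?_
    · have hy' := (tendsto_const_nhds (x := y)).sub hψlim
      have hz' := hlim1.sub hψlim
      exact ((((hgradlim.inner hy').add ((hy'.norm.pow 2).const_mul _)).const_add _).sub
        ((hgradlim.inner hz').add ((hz'.norm.pow 2).const_mul _)))
    · refine Eventually.of_forall fun j => ?_
      have h := prox_step_le hg_proper hγ (hx (ψ j)).2 hy
      rw [← coe_finitePart hg_proper (hxg (ψ j + 1) (by omega)), EReal.coe_le_coe_iff]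
      linarith
  have hbarg : xbar ∈ dom g := by
    obtain ⟨y, hy⟩ := hg_proper.2
    exact (hprox_real y hy).trans_lt (EReal.coe_lt_top _)
  have hbarX : xbar ∈ Xpi f g := by
    refine ⟨hbarf, Set.mem_add.2 ⟨_, rfl, -grad f xbar, ?_, add_neg_cancel _⟩⟩
    refine ⟨hbarg, 1 / (2 * γ), by positivity, 1, one_pos, fun y _ => ?_⟩
    by_cases hy : y ∈ dom g
    · have h := hprox_real y hy
      rw [← coe_finitePart hg_proper hbarg, EReal.coe_le_coe_iff] at h
      rw [← coe_finitePart hg_proper hbarg, ← coe_finitePart hg_proper hy, ← EReal.coe_add,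
        EReal.coe_le_coe_iff, inner_neg_left]
      simp only [sub_self, inner_zero_right, norm_zero] at h
      linarith
    · rw [show g y = ⊤ from not_lt_top_iff.1 hy]
      exact le_top
  refine ⟨hbarX, ?_⟩
  rintro ⟨-, ε, hε, hsep⟩ ⟨-, U, hU, W, hW, κ, hκ, hcalm⟩
  -- Values decrease along the sequence, and `Φ xbar` is at most their limit by continuity of `f` at
  -- `xbar` and lower semicontinuity of `g`.
  have hV : ∀ k, 1 ≤ k → 0 ≤ Φ (x k) - Φ xbar := by
    intro k hk
    have hmono : ∀ j, k ≤ j → Φ (x j) ≤ Φ (x k) := by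
      intro j hj
      induction j, hj using Nat.le_induction with
      | base => exact le_rfl
      | succ j hj ih =>
        have h1 := hdesc j (by omega)
        have h2 : 0 ≤ a * ‖x (j + 1) - x j‖ ^ 2 := by positivity
        linarith
    have hflim : Tendsto (fun j => finitePart f (x (ψ j))) atTop (𝓝 (finitePart f xbar)) :=
      (hgrad xbar hbarf).continuousAt.tendsto.comp hψlim
    have h := lsc_le_of_tendsto hg_lsc hψlim (hflim.const_sub (Φ (x k)))
      ((hψ.tendsto_atTop.eventually_ge_atTop k).mono fun j hj => by
        have h1 := hmono (ψ j) hj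
        simp only [Function.comp_apply]
        rw [← coe_finitePart hg_proper (hxg (ψ j) (by omega)), EReal.coe_le_coe_iff]
        simp only [hΦ] at h1 ⊢
        linarith)
    rw [← coe_finitePart hg_proper hbarg, EReal.coe_le_coe_iff] at h
    simp only [hΦ] at h ⊢
    linarith
  set p : ℕ → Vec n := fun k =>
    grad f (x (k + 1)) - grad f (x k) - (1 / γ) • (x (k + 1) - x k) with hp_def
  have hpS : ∀ k, x (k + 1) ∈ Scano f g (p k) := fun k =>
    mem_Scano_of_mem_prox hg_proper hγ (hxf (k + 1)) (hx k).2
  have hp_le : ∀ k, 1 ≤ k → ‖p k‖ ≤ (L + 1 / γ) * ‖x (k + 1) - x k‖ := by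
    intro k hk
    refine (norm_sub_le _ _).trans ?_
    rw [norm_smul, Real.norm_of_nonneg (by positivity), add_mul]
    gcongr
    exact hf_lip _ (hxC _ (by omega)) _ (hxC k hk)
  have hp0 : Tendsto p atTop (𝓝 0) := by
    rw [tendsto_zero_iff_norm_tendsto_zero]
    have h : Tendsto (fun k => (L + 1 / γ) * ‖x (k + 1) - x k‖) atTop (𝓝 0) := by
      simpa using hd0.const_mul (L + 1 / γ)
    exact squeeze_zero' (Eventually.of_forall fun k => norm_nonneg _)
      ((eventually_ge_atTop 1).mono fun k hk => hp_le k hk) h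
  have hκp : Tendsto (fun k => κ * ‖p k‖) atTop (𝓝 0) := by
    simpa using hp0.norm.const_mul κ
  obtain ⟨N, hN⟩ := eventually_atTop.1 ((hp0.eventually hU).and
    ((hκp.eventually_lt_const (show (0 : ℝ) < ε / 2 by positivity)).and (eventually_ge_atTop 1)))
  obtain ⟨δ₁, hδ₁, hδW⟩ := Metric.mem_nhds_iff.1 hW
  set K : ℝ := κ * (L + 1 / γ) with hK_def
  have hK : 0 ≤ K := by positivity
  -- Here `K * d` bounds the distance from `x (k + 1)` to the stationary point `z`. The three
  -- summands bound the gradient mismatch, the proximal term at `z`, and the curvature between `z`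
  -- and `x (k + 1)`. The radius puts the iterate in `W` and `z` within `ε` of `xbar`.
  have herr : ∀ k, N ≤ k → ‖x (k + 1) - xbar‖ < min δ₁ (ε / 2) → Φ (x (k + 1)) - Φ xbar ≤
      (L * (K + 1) * K + 1 / (2 * γ) * (K + 1) ^ 2 + L / 2 * K ^ 2) *
        ‖x (k + 1) - x k‖ ^ 2 := by
    intro k hk hkδ
    obtain ⟨hkU, hkε, hk1⟩ := hN k hk
    have hkW : x (k + 1) ∈ W := hδW (by
      rw [Metric.mem_ball, dist_eq_norm]
      exact hkδ.trans_le (min_le_left _ _))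
    obtain ⟨z, hz, w, hw, hzw⟩ := Set.mem_add.1 (hcalm (p k) hkU ⟨hpS k, hkW⟩)
    have hzX : z ∈ Xpi f g := hz
    have hw_le : ‖w‖ ≤ κ * ‖p k‖ := by
      obtain ⟨b, hb, rfl⟩ := Set.mem_smul_set.1 hw
      rw [mem_closedBall_zero_iff] at hb
      rw [sub_zero, norm_smul, Real.norm_of_nonneg (by positivity)]
      exact mul_le_of_le_one_right (by positivity) hb
    have hzd := mem_dom_of_mem_Xpi hzX
    have hzv : ‖x (k + 1) - z‖ ≤ κ * ‖p k‖ := by rwa [← hzw, add_sub_cancel_left]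
    have hzball : z ∈ Metric.ball xbar ε := by
      rw [Metric.mem_ball, dist_eq_norm]
      have h1 := norm_sub_le_norm_sub_add_norm_sub z (x (k + 1)) xbar
      rw [norm_sub_rev z (x (k + 1))] at h1
      have h2 := hkδ.trans_le (min_le_right _ _)
      linarith
    have hΦz : Φ z = Φ xbar := by
      have h := hsep z ⟨hzX, hzball⟩
      rw [← hΦF z hzd, ← hΦF xbar ⟨hbarf, hbarg⟩] at h
      exact_mod_cast h
    set d := ‖x (k + 1) - x k‖ with hd_def
    have hd : 0 ≤ d := norm_nonneg _
    have hzK : ‖z - x (k + 1)‖ ≤ K * d := by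
      rw [norm_sub_rev, hK_def, mul_assoc]
      exact hzv.trans (by gcongr; exact hp_le k hk1)
    have hzK1 : ‖z - x k‖ ≤ (K + 1) * d := by
      have h1 := norm_sub_le_norm_sub_add_norm_sub z (x (k + 1)) (x k)
      linarith
    have h1 := prox_step_le hg_proper hγ (hx k).2 hzd.2
    have h2 := hdl z (hC_sup hzd) _ (hxC (k + 1) (by omega))
    -- Basing the descent lemma at `z` merges all first-order terms into one gradient difference,
    -- making them second order in `d`.
    have h3 : inner ℝ (grad f (x k)) (z - x k) - inner ℝ (grad f (x k)) (x (k + 1) - x k) +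
        inner ℝ (grad f z) (x (k + 1) - z) =
        inner ℝ (grad f (x k) - grad f z) (z - x (k + 1)) := by
      rw [inner_sub_left, ← inner_sub_right, sub_sub_sub_cancel_right,
        ← neg_sub z (x (k + 1)), inner_neg_right]
      ring
    have h4 : inner ℝ (grad f (x k) - grad f z) (z - x (k + 1)) ≤
        L * ((K + 1) * d) * (K * d) := by
      refine (real_inner_le_norm _ _).trans ?_
      have h := hf_lip _ (hxC k hk1) _ (hC_sup hzd)
      rw [norm_sub_rev (x k) z] at h
      have h' : L * ‖z - x k‖ ≤ L * ((K + 1) * d) := by gcongr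
      exact mul_le_mul (h.trans h') hzK (norm_nonneg _) (by positivity)
    have h5 : 1 / (2 * γ) * ‖z - x k‖ ^ 2 ≤ 1 / (2 * γ) * ((K + 1) * d) ^ 2 := by gcongr
    have h6 : L / 2 * ‖x (k + 1) - z‖ ^ 2 ≤ L / 2 * (K * d) ^ 2 := by
      rw [norm_sub_rev]
      gcongr
    have h7 : 0 ≤ 1 / (2 * γ) * d ^ 2 := by positivity
    rw [← hΦz]
    simp only [hΦ]
    linarith
  obtain ⟨hlim, k₀, hk₀, σ, ρ₀, ρ, hσ0, hσ1, hρ₀, hρ, hρ1, hrate⟩ :=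
    linear_convergence_of_descent (V := fun k => Φ (x k) - Φ xbar) (N := N) ha
      (by positivity) (lt_min hδ₁ (by positivity)) hxbar
      (fun k hk => hV k (hN k hk).2.2)
      (fun k hk => by linarith [hdesc k (hN k hk).2.2]) herr
  have hdomF : ∀ y ∈ dom f ∩ dom g, y ∈ dom (fun y => f y + g y) := by
    intro y hy
    change f y + g y < ⊤
    rw [← hΦF y hy]
    exact EReal.coe_lt_top _
  refine ⟨hlim, hdomF _ ⟨hbarf, hbarg⟩, k₀, σ, ρ₀, ρ, hσ0, hσ1, hρ₀, hρ, hρ1, fun k hk => ?_⟩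
  have hk1 : 1 ≤ k := (hN k (hk₀.trans hk)).2.2
  refine ⟨hdomF _ ⟨hxf k, hxg k hk1⟩, ?_, (hrate k hk).2⟩
  change (f _ + g _).toReal - (f _ + g _).toReal ≤ σ * ((f _ + g _).toReal - (f _ + g _).toReal)
  rw [← hΦF _ ⟨hxf k, hxg k hk1⟩, ← hΦF _ ⟨hxf (k + 1), hxg (k + 1) (by omega)⟩,
    ← hΦF _ ⟨hbarf, hbarg⟩, EReal.toReal_coe, EReal.toReal_coe, EReal.toReal_coe]
  exact (hrate k hk).1
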